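/- Let $I=[0,1]$, let $\varepsilon>0$, and let $f\colon I\to I$ be continuous. For a compact metric space $(X,d)$ and a continuous map $g\colon X\to X$, call $g$ densely $\varepsilon$-chaotic if the set of pairs $(x,y)\in X\times X$ with $$\liminf_{n\to\infty} d(g^n(x),g^n(y))=0\quad\text{and}\quad \limsup_{n\to\infty} d(g^n(x),g^n(y))>\varepsilon$$ is dense in $X\times X$. Let $\mathcal K(I)$ be the space of all non-empty compact subsets of $I$ with the Hausdorff metric, and let $\overline f\colon\mathcal K(I)\to\mathcal K(I)$, $\overline f(K)=f(K)$, be the map induced by $f$. If $f$ is densely $\varepsilon$-chaotic, then $\overline f$ is densely $\varepsilon$-chaotic (with the same $\varepsilon$). -/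

import Mathlib

open Filter TopologicalSpace

namespace DenseChaos

variable {X : Type*} [MetricSpace X] [CompactSpace X]

/-- The set `C₁(f)` of pairs `(x, y)` with `liminf d(fⁿ x, fⁿ y) = 0`
(the distances are bounded, since `X` is compact). -/
def C₁ (f : C(X, X)) : Set (X × X) :=
  {p | liminf (fun n : ℕ => dist (f^[n] p.1) (f^[n] p.2)) atTop = 0}

/-- The set `C₂(f, ε)` of pairs `(x, y)` with `limsup d(fⁿ x, fⁿ y) > ε`. -/
def C₂ (f : C(X, X)) (ε : ℝ) : Set (X × X) :=
  {p | ε < limsup (fun n : ℕ => dist (f^[n] p.1) (f^[n] p.2)) atTop}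

/-- The set `C(f, ε) = C₁(f) ∩ C₂(f, ε)` of `ε`-Li-Yorke pairs of `f`. -/
def liYorkePairs (f : C(X, X)) (ε : ℝ) : Set (X × X) :=
  C₁ f ∩ C₂ f ε

/-- `f` is densely `ε`-chaotic: its `ε`-Li-Yorke pairs are dense in `X × X`. -/
def DenselyChaotic (f : C(X, X)) (ε : ℝ) : Prop :=
  Dense (liYorkePairs f ε)


/-- The map `K ↦ f(K)` induced by `f` on the space `NonemptyCompacts X` of non-empty compact
subsets of `X`, which carries the Hausdorff metric. -/
def induced (f : C(X, X)) : C(NonemptyCompacts X, NonemptyCompacts X) where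
  toFun K := K.map f f.continuous
  continuous_toFun := by fun_prop

end DenseChaos

namespace DenseChaos

-- Li-Yorke pairs in terms of times, and proximality along progressions

section LiYorke

variable {X : Type*} [MetricSpace X]

-- Dense ε-chaos of f makes every open interval grow longer than ε infinitely often. By minimality
-- over a finite net, every non-empty open set then contains a recurrent interval J: each non-empty
-- open W ⊆ J covers f^T(J) at a later time (`exists_isRecurrentAt`). For finitely many such
-- intervals J_i, common T and D make f^(T+kD)(J_i) increase with k to intervals S_i, and any tuple
-- P_i ∈ S_i is hit simultaneously, arbitrarily late, from any non-empty open W_i ⊆ J_i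
-- (`exists_iterate_eq`).
--
-- Proximal pairs put the S_i pairwise at distance zero, and recurrence forces two of them with two
-- common points to coincide. Hence some tuples are nearly constant, and some tuple has its i₀-th
-- entry farther than ε from all the others (`exists_forall_lt_dist`). Baire category yields points
-- x_i showing both behaviours infinitely often. Splitting them into two finite sets near K and L
-- gives the required pair: one point far from the whole other set already makes the Hausdorff
-- distance large.

theorem isBoundedUnder_ge_dist (f : X → X) (p : X × X) :
    IsBoundedUnder (· ≥ ·) atTop (fun n : ℕ => dist (f^[n] p.1) (f^[n] p.2)) :=
  isBoundedUnder_of ⟨0, fun _ => dist_nonneg⟩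

theorem exists_dist_gt_of_mem_C₂ {f : C(X, X)} {ε : ℝ} {p : X × X} (h : p ∈ C₂ f ε) (N : ℕ) :
    ∃ n ≥ N, ε < dist (f^[n] p.1) (f^[n] p.2) :=
  frequently_atTop.1 (frequently_lt_of_lt_limsup
    (isBoundedUnder_ge_dist f p).isCoboundedUnder_le h) N

variable [CompactSpace X]

theorem isBoundedUnder_le_dist (f : X → X) (p : X × X) :
    IsBoundedUnder (· ≤ ·) atTop (fun n : ℕ => dist (f^[n] p.1) (f^[n] p.2)) :=
  isBoundedUnder_of ⟨Metric.diam (Set.univ : Set X), fun _ =>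
    Metric.dist_le_diam_of_mem isCompact_univ.isBounded (Set.mem_univ _) (Set.mem_univ _)⟩

theorem mem_C₁_iff {f : C(X, X)} {p : X × X} :
    p ∈ C₁ f ↔ ∀ η > 0, ∀ N : ℕ, ∃ n ≥ N, dist (f^[n] p.1) (f^[n] p.2) < η := by
  have hb := isBoundedUnder_le_dist f p
  have hb' := isBoundedUnder_ge_dist f p
  constructor
  · intro h η hη
    have h' : liminf (fun n : ℕ => dist (f^[n] p.1) (f^[n] p.2)) atTop < η := by
      rw [show liminf (fun n : ℕ => dist (f^[n] p.1) (f^[n] p.2)) atTop = 0 from h]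
      exact hη
    exact frequently_atTop.1 (frequently_lt_of_liminf_lt hb.isCoboundedUnder_ge h')
  · intro h
    apply le_antisymm
    · refine le_of_forall_pos_le_add fun η hη => ?_
      rw [zero_add]
      exact liminf_le_of_frequently_le
        (frequently_atTop.2 fun N => (h η hη N).imp fun n hn => ⟨hn.1, hn.2.le⟩) hb'
    · exact le_liminf_of_le hb.isCoboundedUnder_ge (Eventually.of_forall fun _ => dist_nonneg)

theorem mem_C₂_of_frequently {f : C(X, X)} {ε δ : ℝ} {p : X × X} (hδ : ε < δ)
    (h : ∀ N : ℕ, ∃ n ≥ N, δ ≤ dist (f^[n] p.1) (f^[n] p.2)) : p ∈ C₂ f ε :=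
  hδ.trans_le (le_limsup_of_frequently_le (frequently_atTop.2 h) (isBoundedUnder_le_dist f p))

/-- Every two non-empty open sets contain the two points of an `ε`-Li-Yorke pair. -/
def HasLiYorkePairs (f : X → X) (ε : ℝ) : Prop :=
  ∀ U V : Set X, IsOpen U → U.Nonempty → IsOpen V → V.Nonempty → ∃ x ∈ U, ∃ y ∈ V,
    (∀ η > 0, ∀ N : ℕ, ∃ n ≥ N, dist (f^[n] x) (f^[n] y) < η) ∧
    ∀ N : ℕ, ∃ n ≥ N, ε < dist (f^[n] x) (f^[n] y)

theorem DenselyChaotic.hasLiYorkePairs {f : C(X, X)} {ε : ℝ} (hf : DenselyChaotic f ε) :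
    HasLiYorkePairs f ε := by
  intro U V hU hU' hV hV'
  obtain ⟨⟨x, y⟩, ⟨hx, hy⟩, h₁, h₂⟩ := hf.inter_open_nonempty _ (hU.prod hV) (hU'.prod hV')
  exact ⟨x, hx, y, hy, mem_C₁_iff.1 h₁, exists_dist_gt_of_mem_C₂ h₂⟩

theorem exists_forall_iterate_dist_lt {f : X → X} (hf : Continuous f) {η : ℝ} (hη : 0 < η)
    (D : ℕ) : ∃ δ > 0, ∀ s ≤ D, ∀ x y, dist x y < δ → dist (f^[s] x) (f^[s] y) < η := by
  induction D with
  | zero => exact ⟨η, hη, fun s hs x y h => by simpa [Nat.le_zero.1 hs] using h⟩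
  | succ D ih =>
    obtain ⟨δ, hδ, h⟩ := ih
    obtain ⟨δ', hδ', h'⟩ := Metric.uniformContinuous_iff.1
      (CompactSpace.uniformContinuous_of_continuous (hf.iterate (D + 1))) η hη
    refine ⟨min δ δ', lt_min hδ hδ', fun s hs x y hxy => ?_⟩
    rcases Nat.le_succ_iff.1 hs with hs | rfl
    · exact h s hs x y (hxy.trans_le (min_le_left _ _))
    · exact h' (hxy.trans_le (min_le_right _ _))

/-- A proximal pair is proximal along every arithmetic progression. -/
theorem exists_dist_lt_arith {f : X → X} (hf : Continuous f) {x y : X}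
    (h : ∀ η > 0, ∀ N : ℕ, ∃ n ≥ N, dist (f^[n] x) (f^[n] y) < η) {η : ℝ} (hη : 0 < η)
    (T : ℕ) {D : ℕ} (hD : 0 < D) : ∃ k, dist (f^[T + k * D] x) (f^[T + k * D] y) < η := by
  -- Closeness δ at a time n survives as closeness η for D more steps, hence up to the next term of
  -- the progression.
  obtain ⟨δ, hδ, hs⟩ := exists_forall_iterate_dist_lt hf hη D
  obtain ⟨n, hn, hlt⟩ := h δ hδ T
  have h₁ := Nat.div_add_mod (n - T) D
  have h₂ := Nat.mod_lt (n - T) hD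
  refine ⟨(n - T) / D + 1, ?_⟩
  have h₃ : T + ((n - T) / D + 1) * D = (D - (n - T) % D) + n := by
    have : ((n - T) / D + 1) * D = D * ((n - T) / D) + D := by ring
    omega
  rw [h₃, Function.iterate_add_apply, Function.iterate_add_apply]
  exact hs _ (Nat.sub_le _ _) _ _ hlt

end LiYorke

-- Recurrent sets and common return times

section Recurrence

variable {X : Type*}

/-- Every non-empty open subset of `J` has, at a time later than `T`, an image that covers
the image of `J` at time `T`. -/
def IsRecurrentAt [TopologicalSpace X] (f : X → X) (J : Set X) (T : ℕ) : Prop :=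
  ∀ W ⊆ J, IsOpen W → W.Nonempty → ∃ n, 0 < n ∧ f^[T] '' J ⊆ f^[T + n] '' W

variable {f : X → X} {J W : Set X} {T : ℕ}

theorem image_iterate_subset_of_subset {A B : Set X} {a b : ℕ} (h : f^[a] '' A ⊆ f^[b] '' B)
    (s : ℕ) : f^[a + s] '' A ⊆ f^[b + s] '' B := by
  rw [add_comm a, add_comm b, Function.iterate_add, Function.iterate_add, Set.image_comp,
    Set.image_comp]
  exact Set.image_mono h

theorem IsRecurrentAt.mono [TopologicalSpace X] (h : IsRecurrentAt f J T) {T' : ℕ} (hT : T ≤ T') :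
    IsRecurrentAt f J T' := by
  intro W hW ho hne
  obtain ⟨n, hn, hs⟩ := h W hW ho hne
  refine ⟨n, hn, ?_⟩
  have := image_iterate_subset_of_subset hs (T' - T)
  rwa [show T + (T' - T) = T' by omega, show T + n + (T' - T) = T' + n by omega] at this

/-- Since W ⊆ J, the covering relation can be iterated. Having all multiples of n available is what
allows common return times for several sets. -/
theorem IsRecurrentAt.exists_forall_dvd [TopologicalSpace X] (h : IsRecurrentAt f J T)
    (hW : W ⊆ J) (ho : IsOpen W) (hne : W.Nonempty) :
    ∃ n, 0 < n ∧ ∀ m, 0 < m → n ∣ m → f^[T] '' J ⊆ f^[T + m] '' W := by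
  obtain ⟨n, hn, hs⟩ := h W hW ho hne
  refine ⟨n, hn, ?_⟩
  have key : ∀ k, f^[T] '' J ⊆ f^[T + n * (k + 1)] '' W := by
    intro k
    induction k with
    | zero => simpa using hs
    | succ k ih =>
      refine ih.trans ((Set.image_mono hW).trans ?_)
      have := image_iterate_subset_of_subset hs (n * (k + 1))
      rwa [show T + n + n * (k + 1) = T + n * (k + 1 + 1) by ring] at this
  rintro m hm ⟨k, rfl⟩
  obtain ⟨k, rfl⟩ : ∃ l, k = l + 1 := ⟨k - 1, by have := Nat.pos_of_mul_pos_left hm; omega⟩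
  exact key k

/-- The union of the images of `J` along the arithmetic progression `T + kD`. -/
def orbitHull (f : X → X) (T D : ℕ) (J : Set X) : Set X :=
  ⋃ k : ℕ, f^[T + k * D] '' J

theorem subset_orbitHull (f : X → X) (T D k : ℕ) (J : Set X) :
    f^[T + k * D] '' J ⊆ orbitHull f T D J :=
  Set.subset_iUnion (fun k : ℕ => f^[T + k * D] '' J) k

theorem image_iterate_arith_mono {D : ℕ} (hD : f^[T] '' J ⊆ f^[T + D] '' J) :
    Monotone fun k : ℕ => f^[T + k * D] '' J := by
  refine monotone_nat_of_le_succ fun k => ?_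
  have := image_iterate_subset_of_subset hD (k * D)
  rwa [show T + D + k * D = T + (k + 1) * D by ring] at this

theorem exists_forall_mem_image {ι : Type*} [Finite ι] {D : ℕ} {J : ι → Set X}
    (hD : ∀ i, f^[T] '' J i ⊆ f^[T + D] '' J i) {P : ι → X}
    (hP : ∀ i, P i ∈ orbitHull f T D (J i)) : ∃ K, ∀ i, P i ∈ f^[T + K * D] '' J i := by
  choose k hk using fun i => Set.mem_iUnion.1 (hP i)
  obtain ⟨K, hK⟩ := (Set.finite_range k).bddAbove
  exact ⟨K, fun i => image_iterate_arith_mono (hD i) (hK ⟨i, rfl⟩) (hk i)⟩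

/-- A multiple of the product of the return times brings every W i over the image of J i at time T;
K * D further steps, with K common to all i, reach P i. -/
theorem exists_iterate_eq [TopologicalSpace X] {ι : Type*} [Fintype ι] {D : ℕ} {J : ι → Set X}
    (hJ : ∀ i, IsRecurrentAt f (J i) T)
    (hD : ∀ i, f^[T] '' J i ⊆ f^[T + D] '' J i) {P : ι → X}
    (hP : ∀ i, P i ∈ orbitHull f T D (J i)) {W : ι → Set X} (hW : ∀ i, W i ⊆ J i)
    (ho : ∀ i, IsOpen (W i)) (hne : ∀ i, (W i).Nonempty) (N : ℕ) :
    ∃ n ≥ N, ∀ i, ∃ w ∈ W i, f^[n] w = P i := by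
  obtain ⟨K, hK⟩ := exists_forall_mem_image hD hP
  choose n hn hs using fun i => (hJ i).exists_forall_dvd (hW i) (ho i) (hne i)
  have hpos : 0 < (∏ i, n i) := Finset.prod_pos fun i _ => hn i
  refine ⟨T + (∏ i, n i) * (N + 1) + K * D, ?_, fun i => ?_⟩
  · nlinarith [Nat.zero_le (K * D)]
  · have h₁ := hs i ((∏ i, n i) * (N + 1)) (by positivity)
      ((Finset.dvd_prod_of_mem n (Finset.mem_univ i)).mul_right _)
    exact image_iterate_subset_of_subset h₁ (K * D) (hK i)

theorem exists_pos_forall_image_subset [TopologicalSpace X] {ι : Type*} [Fintype ι] {J : ι → Set X}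
    (hJ : ∀ i, IsRecurrentAt f (J i) T) (ho : ∀ i, IsOpen (J i)) (hne : ∀ i, (J i).Nonempty) :
    ∃ D, 0 < D ∧ ∀ i, f^[T] '' J i ⊆ f^[T + D] '' J i := by
  choose n hn hs using fun i => (hJ i).exists_forall_dvd subset_rfl (ho i) (hne i)
  have hpos : 0 < (∏ i, n i) := Finset.prod_pos fun i _ => hn i
  exact ⟨_, hpos, fun i => hs i _ hpos (Finset.dvd_prod_of_mem n (Finset.mem_univ i))⟩

end Recurrence

-- Interval dynamics: recurrent intervals and their orbit hulls

section Interval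

variable {f : unitInterval → unitInterval} {ε : ℝ}

theorem ordConnected_ball (x : unitInterval) (r : ℝ) : (Metric.ball x r).OrdConnected := by
  refine ⟨fun a ha b hb c hc => ?_⟩
  have h₁ : (a : ℝ) ≤ c := hc.1
  have h₂ : (c : ℝ) ≤ b := hc.2
  rw [Metric.mem_ball, Subtype.dist_eq, Real.dist_eq, abs_lt] at *
  constructor <;> linarith

theorem exists_open_ordConnected_subset {V : Set unitInterval} (hV : IsOpen V)
    (hne : V.Nonempty) : ∃ J ⊆ V, IsOpen J ∧ J.Nonempty ∧ J.OrdConnected := by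
  obtain ⟨x, hx⟩ := hne
  obtain ⟨r, hr, h⟩ := Metric.isOpen_iff.1 hV x hx
  exact ⟨_, h, Metric.isOpen_ball, ⟨x, Metric.mem_ball_self hr⟩, ordConnected_ball x r⟩

theorem ordConnected_image_iterate (hf : Continuous f) {J : Set unitInterval}
    (hJ : J.OrdConnected) (n : ℕ) : (f^[n] '' J).OrdConnected :=
  (hJ.isPreconnected.image _ (hf.iterate n).continuousOn).ordConnected

theorem exists_ball_subset_of_dist_lt {S : Set unitInterval} (hS : S.OrdConnected)
    {x y : unitInterval} (hx : x ∈ S) (hy : y ∈ S) (h : ε < dist x y) :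
    ∃ z, Metric.ball z (ε / 2) ⊆ S := by
  wlog hxy : x ≤ y generalizing x y
  · exact this hy hx (by rwa [dist_comm]) (le_of_not_ge hxy)
  have hxy' : (x : ℝ) ≤ y := hxy
  rw [Subtype.dist_eq, Real.dist_eq, abs_sub_comm, abs_of_nonneg (by linarith)] at h
  refine ⟨⟨((x : ℝ) + y) / 2, ?_, ?_⟩, fun w hw => hS.out hx hy ?_⟩
  · linarith [x.2.1, y.2.1]
  · linarith [x.2.2, y.2.2]
  · rw [Metric.mem_ball, Subtype.dist_eq, Real.dist_eq, abs_lt] at hw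
    constructor
    · show (x : ℝ) ≤ w
      linarith [hw.1]
    · show (w : ℝ) ≤ y
      linarith [hw.2]

open Classical in
/-- The members of `A` whose balls of radius `ε / 4` are covered infinitely often by the
images of `W`. -/
noncomputable def coveredCenters (f : unitInterval → unitInterval) (ε : ℝ)
    (A : Finset unitInterval) (W : Set unitInterval) : Finset unitInterval :=
  A.filter fun p => ∃ᶠ n in atTop, Metric.ball p (ε / 4) ⊆ f^[n] '' W

theorem coveredCenters_mono {A : Finset unitInterval} {W W' : Set unitInterval} (h : W ⊆ W') :
    coveredCenters f ε A W ⊆ coveredCenters f ε A W' := by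
  classical
  intro p hp
  rw [coveredCenters, Finset.mem_filter] at hp ⊢
  exact ⟨hp.1, hp.2.mono fun n hn => hn.trans (Set.image_mono h)⟩

/-- An image of diameter above ε contains a ball of radius ε / 2, hence the ε / 4-ball of a nearby
net point; by pigeonhole one net point recurs. -/
theorem coveredCenters_nonempty (hf : Continuous f) (hLY : HasLiYorkePairs f ε)
    {A : Finset unitInterval} (hA : ∀ x, ∃ p ∈ A, dist x p < ε / 4)
    {W : Set unitInterval} (ho : IsOpen W) (hne : W.Nonempty) :
    (coveredCenters f ε A W).Nonempty := by
  classical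
  obtain ⟨J, hJW, hJo, hJne, hJ⟩ := exists_open_ordConnected_subset ho hne
  obtain ⟨x, hx, y, hy, -, hfar⟩ := hLY J J hJo hJne hJo hJne
  have hcov : ∃ᶠ n in atTop, ∃ p : A, Metric.ball (p : unitInterval) (ε / 4) ⊆ f^[n] '' W := by
    refine frequently_atTop.2 fun N => ?_
    obtain ⟨n, hn, hd⟩ := hfar N
    obtain ⟨z, hz⟩ := exists_ball_subset_of_dist_lt (ordConnected_image_iterate hf hJ n)
      (Set.mem_image_of_mem _ hx) (Set.mem_image_of_mem _ hy) hd
    obtain ⟨p, hp, hzp⟩ := hA z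
    refine ⟨n, hn, ⟨p, hp⟩, (Metric.ball_subset_ball' ?_).trans (hz.trans (Set.image_mono hJW))⟩
    rw [dist_comm]
    linarith
  obtain ⟨p, hp⟩ : ∃ p : A, ∃ᶠ n in atTop,
      Metric.ball (p : unitInterval) (ε / 4) ⊆ f^[n] '' W := by
    by_contra hcon
    simp only [not_exists, not_frequently] at hcon
    exact hcov ((eventually_all.2 hcon).mono fun n hn => by simpa using hn)
  exact ⟨p, Finset.mem_filter.2 ⟨p.2, hp⟩⟩

theorem exists_isRecurrentAt (hε : 0 < ε) (hf : Continuous f) (hLY : HasLiYorkePairs f ε)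
    {V : Set unitInterval} (hV : IsOpen V) (hne : V.Nonempty) :
    ∃ J ⊆ V, IsOpen J ∧ J.Nonempty ∧ J.OrdConnected ∧ ∃ T, IsRecurrentAt f J T := by
  classical
  obtain ⟨A₀, -, hA₀, hcov⟩ := (isCompact_univ (X := unitInterval)).finite_cover_balls
    (show 0 < ε / 4 by linarith)
  lift A₀ to Finset unitInterval using hA₀
  have hA : ∀ x, ∃ p ∈ A₀, dist x p < ε / 4 := fun x => by
    simpa using hcov (Set.mem_univ x)
  -- With the set of covered centers minimal, all open subsets of W cover the same balls infinitely
  -- often. J is then cut down so that its image at time T lies in one of these balls.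
  obtain ⟨S, ⟨W, hWV, hWo, hWne, rfl⟩, hmin⟩ :=
    (wellFounded_lt (α := Finset unitInterval)).has_min
      {S | ∃ W ⊆ V, IsOpen W ∧ W.Nonempty ∧ coveredCenters f ε A₀ W = S}
      ⟨_, V, subset_rfl, hV, hne, rfl⟩
  have heq : ∀ W' ⊆ W, IsOpen W' → W'.Nonempty →
      coveredCenters f ε A₀ W' = coveredCenters f ε A₀ W := fun W' h ho hn =>
    (coveredCenters_mono h).eq_of_not_ssubset
      (hmin _ ⟨W', h.trans hWV, ho, hn, rfl⟩)
  obtain ⟨p, hp⟩ := coveredCenters_nonempty hf hLY hA hWo hWne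
  have hret : ∀ W' ⊆ W, IsOpen W' → W'.Nonempty →
      ∃ᶠ n in atTop, Metric.ball p (ε / 4) ⊆ f^[n] '' W' := fun W' h ho hn => by
    rw [← heq W' h ho hn] at hp
    exact (Finset.mem_filter.1 hp).2
  obtain ⟨T, hT⟩ := (hret W subset_rfl hWo hWne).exists
  obtain ⟨x, hxW, hxp⟩ := hT (Metric.mem_ball_self (show 0 < ε / 4 by linarith))
  obtain ⟨J, hJ, hJo, hJne, hJc⟩ := exists_open_ordConnected_subset
    (hWo.inter (Metric.isOpen_ball.preimage (hf.iterate T)))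
    ⟨x, hxW, show f^[T] x ∈ Metric.ball p (ε / 4) by
      rw [hxp]; exact Metric.mem_ball_self (by linarith)⟩
  refine ⟨J, fun z hz => hWV (hJ hz).1, hJo, hJne, hJc, T, fun W' hW' ho hn => ?_⟩
  obtain ⟨n, hnT, hn'⟩ :=
    frequently_atTop.1 (hret W' (fun z hz => (hJ (hW' hz)).1) ho hn) (T + 1)
  refine ⟨n - T, by omega, ?_⟩
  rw [show T + (n - T) = n by omega]
  refine Set.Subset.trans ?_ hn'
  rintro _ ⟨z, hz, rfl⟩
  exact (hJ hz).2

/-- Finitely many order-connected sets that pairwise almost meet almost have a common point. -/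
theorem exists_pairwise_dist_lt {ι : Type*} [Finite ι] {S : ι → Set unitInterval}
    (hS : ∀ i, (S i).OrdConnected) {η : ℝ} (hη : 0 < η)
    (h : ∀ i j, ∃ x ∈ S i, ∃ y ∈ S j, dist x y < η / 2) :
    ∃ P : ι → unitInterval, (∀ i, P i ∈ S i) ∧ ∀ i j, dist (P i) (P j) < η := by
  rcases isEmpty_or_nonempty ι with hι | hι
  · exact ⟨hι.elim, hι.elim, hι.elim⟩
  choose x hx y hy hxy using h
  -- As in Helly's theorem on the line: the minima act as left ends, and the largest of them is
  -- nearly common.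
  choose m hm using fun i => Finite.exists_min (x i)
  obtain ⟨i₀, hi₀⟩ := Finite.exists_max fun i => x i (m i)
  have key : ∀ i, ∃ z ∈ S i, dist z (x i₀ (m i₀)) < η / 2 := by
    intro i
    rcases le_total (x i₀ (m i₀)) (y i₀ i) with hle | hle
    · exact ⟨_, (hS i).out (hx i (m i)) (hy i₀ i) ⟨hi₀ i, hle⟩, by simpa using half_pos hη⟩
    · refine ⟨_, hy i₀ i, ?_⟩
      have h₁ := hxy i₀ i
      have h₂ : (x i₀ (m i₀) : ℝ) ≤ x i₀ i := hm i₀ i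
      have h₃ : (y i₀ i : ℝ) ≤ x i₀ (m i₀) := hle
      rw [Subtype.dist_eq, Real.dist_eq, abs_lt] at h₁ ⊢
      constructor <;> linarith [h₁.2]
  choose P hP hPd using key
  refine ⟨P, hP, fun i j => (dist_triangle_right _ _ (x i₀ (m i₀))).trans_lt ?_⟩
  linarith [hPd i, hPd j]

/-- Among finitely many order-connected sets that pairwise are equal or do not overlap, and
whose pairwise distances vanish, a set of diameter greater than `ε` has a point that is
`ε`-separated from a point of each other set. -/
theorem exists_forall_lt_dist {ι : Type*} {S : ι → Set unitInterval}
    (hS : ∀ i, (S i).OrdConnected) (hnt : ∀ i, (S i).Nontrivial) (hε : 0 < ε)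
    (hnear : ∀ i j, ∀ η > 0, ∃ x ∈ S i, ∃ y ∈ S j, dist x y < η)
    (hover : ∀ i j a b, a < b → a ∈ S i → b ∈ S i → a ∈ S j → b ∈ S j → S i ⊆ S j)
    {i₀ : ι} {u v : unitInterval} (hu : u ∈ S i₀) (hv : v ∈ S i₀) (huv : ε < dist u v) :
    ∃ P : ι → unitInterval, (∀ i, P i ∈ S i) ∧ ∀ j, j ≠ i₀ → ε < dist (P i₀) (P j) := by
  classical
  wlog hlt : u ≤ v generalizing u v
  · exact this hv hu (by rwa [dist_comm]) (le_of_not_ge hlt)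
  have hlt' : (u : ℝ) ≤ v := hlt
  have hd : ε < (v : ℝ) - u := by
    rwa [Subtype.dist_eq, Real.dist_eq, abs_sub_comm, abs_of_nonneg (by linarith)] at huv
  have huvlt : u < v := by
    show (u : ℝ) < v
    linarith
  have hfin : ∀ q ∈ S i₀, (∀ j, ∃ p ∈ S j, ε < dist q p) →
      ∃ P : ι → unitInterval, (∀ i, P i ∈ S i) ∧ ∀ j, j ≠ i₀ → ε < dist (P i₀) (P j) := by
    intro q hq hp
    choose p hp hpd using hp
    refine ⟨Function.update p i₀ q, fun i => ?_, fun j hj => ?_⟩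
    · rcases eq_or_ne i i₀ with rfl | hi
      · simpa using hq
      · simpa [hi] using hp i
    · simpa [hj] using hpd j
  -- a set that overlaps the interval `[u, v]` contains both of its ends
  have hoverlap : ∀ j, ∀ s ∈ S j, u < s → s < v → u ∈ S j ∧ v ∈ S j := by
    intro j s hs hus hsv
    obtain ⟨t, ht, hts⟩ := (hnt j).exists_ne s
    have hsub : S i₀ ⊆ S j := by
      rcases lt_or_gt_of_ne hts with hts | hts
      · have hmax : max t u < s := max_lt hts hus
        exact hover i₀ j (max t u) s hmax
          ((hS i₀).out hu hv ⟨le_max_right _ _, (hmax.trans hsv).le⟩)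
          ((hS i₀).out hu hv ⟨hus.le, hsv.le⟩)
          ((hS j).out ht hs ⟨le_max_left _ _, hmax.le⟩) hs
      · have hmin : s < min t v := lt_min hts hsv
        exact hover i₀ j s (min t v) hmin
          ((hS i₀).out hu hv ⟨hus.le, hsv.le⟩)
          ((hS i₀).out hu hv ⟨(hus.trans hmin).le, min_le_right _ _⟩) hs
          ((hS j).out hs ht ⟨hmin.le, min_le_left _ _⟩)
    exact ⟨hsub hu, hsub hv⟩
  by_cases hvall : ∀ j, ∃ p ∈ S j, ε < dist v p
  · exact hfin v hv hvall
  by_cases huall : ∀ j, ∃ p ∈ S j, ε < dist u p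
  · exact hfin u hu huall
  push Not at hvall huall
  obtain ⟨j, hj⟩ := hvall
  obtain ⟨k, hk⟩ := huall
  have hj' : ∀ s ∈ S j, (v : ℝ) ≤ s := by
    intro s hs
    by_contra! hsv
    have h₁ := hj s hs
    rw [Subtype.dist_eq, Real.dist_eq, abs_le] at h₁
    have h₂ := (hoverlap j s hs (show (u : ℝ) < s by linarith [h₁.2]) hsv).1
    exact (huv.trans_le (by rw [dist_comm]; exact hj u h₂)).false
  have hk' : ∀ s ∈ S k, (s : ℝ) ≤ u := by
    intro s hs
    by_contra! hsu
    have h₁ := hk s hs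
    rw [Subtype.dist_eq, Real.dist_eq, abs_le] at h₁
    have h₂ := (hoverlap k s hs hsu (show (s : ℝ) < v by linarith [h₁.1])).2
    exact (huv.trans_le (hk v h₂)).false
  obtain ⟨x, hx, y, hy, hxy⟩ := hnear j k ε hε
  have h₁ := hj' x hx
  have h₂ := hk' y hy
  rw [Subtype.dist_eq, Real.dist_eq, abs_lt] at hxy
  linarith [hxy.2]

theorem ordConnected_orbitHull (hf : Continuous f) {J : Set unitInterval} (hJ : J.OrdConnected)
    {T D : ℕ} (hD : f^[T] '' J ⊆ f^[T + D] '' J) : (orbitHull f T D J).OrdConnected := by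
  refine ⟨fun a ha b hb => ?_⟩
  obtain ⟨k, hk⟩ := Set.mem_iUnion.1 ha
  obtain ⟨l, hl⟩ := Set.mem_iUnion.1 hb
  have hmono := image_iterate_arith_mono hD
  exact ((ordConnected_image_iterate hf hJ (T + max k l * D)).out
    (hmono (le_max_left k l) hk) (hmono (le_max_right k l) hl)).trans
    (subset_orbitHull f T D _ J)

/-- At a common time both images contain [a, b]. An open part of J enters (a, b), so its later
images lie in those of J'; by recurrence they cover J's image at time T. -/
theorem orbitHull_subset_of_overlap (hf : Continuous f) {J J' : Set unitInterval}
    (hJ : J.OrdConnected) (hJo : IsOpen J) (hJ' : J'.OrdConnected)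
    {T D : ℕ} (hD₀ : 0 < D) (hrec : IsRecurrentAt f J T) (hD : f^[T] '' J ⊆ f^[T + D] '' J)
    (hD' : f^[T] '' J' ⊆ f^[T + D] '' J') {a b : unitInterval} (hab : a < b)
    (ha : a ∈ orbitHull f T D J) (hb : b ∈ orbitHull f T D J)
    (ha' : a ∈ orbitHull f T D J') (hb' : b ∈ orbitHull f T D J') :
    orbitHull f T D J ⊆ orbitHull f T D J' := by
  obtain ⟨k₁, h₁⟩ := Set.mem_iUnion.1 ha
  obtain ⟨k₂, h₂⟩ := Set.mem_iUnion.1 hb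
  obtain ⟨k₃, h₃⟩ := Set.mem_iUnion.1 ha'
  obtain ⟨k₄, h₄⟩ := Set.mem_iUnion.1 hb'
  set K := max (max k₁ k₂) (max k₃ k₄)
  have hmono := image_iterate_arith_mono hD
  have hmono' := image_iterate_arith_mono hD'
  have hI : Set.Icc a b ⊆ f^[T + K * D] '' J :=
    (ordConnected_image_iterate hf hJ (T + K * D)).out
      (hmono (show k₁ ≤ K by simp [K]) h₁) (hmono (show k₂ ≤ K by simp [K]) h₂)
  have hI' : Set.Icc a b ⊆ f^[T + K * D] '' J' :=
    (ordConnected_image_iterate hf hJ' (T + K * D)).out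
      (hmono' (show k₃ ≤ K by simp [K]) h₃) (hmono' (show k₄ ≤ K by simp [K]) h₄)
  obtain ⟨c, hc⟩ := exists_between hab
  obtain ⟨w, hwJ, hwc⟩ := hI ⟨hc.1.le, hc.2.le⟩
  obtain ⟨n, hn, hs⟩ := hrec.exists_forall_dvd
    (W := J ∩ f^[T + K * D] ⁻¹' Set.Ioo a b) Set.inter_subset_left
    (hJo.inter (isOpen_Ioo.preimage (hf.iterate _))) ⟨w, hwJ, by simpa [hwc] using hc⟩
  -- The delay is a multiple of n for recurrence, a multiple of D to stay in the progression, and at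
  -- least K * D.
  have hbase : f^[T] '' J ⊆ f^[T + (n * (K + 1)) * D] '' J' := by
    refine (hs (n * (K + 1) * D) (by positivity) ⟨(K + 1) * D, by ring⟩).trans ?_
    have hle : K * D ≤ n * (K + 1) * D := Nat.mul_le_mul_right D (by nlinarith)
    have hsub : f^[T + K * D] '' (J ∩ f^[T + K * D] ⁻¹' Set.Ioo a b) ⊆ f^[T + K * D] '' J' := by
      rintro _ ⟨z, hz, rfl⟩
      exact hI' (Set.Ioo_subset_Icc_self hz.2)
    have := image_iterate_subset_of_subset hsub (n * (K + 1) * D - K * D)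
    rwa [show T + K * D + (n * (K + 1) * D - K * D) = T + n * (K + 1) * D by omega] at this
  refine Set.iUnion_subset fun k => ?_
  have := image_iterate_subset_of_subset hbase (k * D)
  rw [show T + n * (K + 1) * D + k * D = T + (n * (K + 1) + k) * D by ring] at this
  exact this.trans (subset_orbitHull f T D _ J')

/-- Simultaneous recurrence of finitely many intervals, with images at a common time that are
mutually close, and others for which one is `ε`-separated from all the rest. -/
theorem exists_simultaneous_iterates (hε : 0 < ε) (hf : Continuous f)
    (hLY : HasLiYorkePairs f ε) {ι : Type*} [Fintype ι] (i₀ : ι) {V : ι → Set unitInterval}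
    (hV : ∀ i, IsOpen (V i)) (hVne : ∀ i, (V i).Nonempty) :
    ∃ J : ι → Set unitInterval, (∀ i, J i ⊆ V i) ∧ (∀ i, IsOpen (J i)) ∧ (∀ i, (J i).Nonempty) ∧
      ∃ R : Set (ι → unitInterval),
        (∀ P ∈ R, ∀ W : ι → Set unitInterval, (∀ i, W i ⊆ J i) → (∀ i, IsOpen (W i)) →
          (∀ i, (W i).Nonempty) → ∀ N, ∃ n ≥ N, ∀ i, ∃ w ∈ W i, f^[n] w = P i) ∧
        (∀ η > 0, ∃ P ∈ R, ∀ i j, dist (P i) (P j) < η) ∧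
        ∃ P ∈ R, ∀ j, j ≠ i₀ → ε < dist (P i₀) (P j) := by
  choose J hJV hJo hJne hJc T₁ hT₁ using fun i => exists_isRecurrentAt hε hf hLY (hV i) (hVne i)
  obtain ⟨T₀, hT₀⟩ := (Set.finite_range T₁).bddAbove
  -- The common time T is also one at which the image of J i₀ is longer than ε.
  obtain ⟨u, hu, v, hv, -, hfar⟩ := hLY _ _ (hJo i₀) (hJne i₀) (hJo i₀) (hJne i₀)
  obtain ⟨T, hT, huv⟩ := hfar T₀
  have hrec : ∀ i, IsRecurrentAt f (J i) T := fun i => (hT₁ i).mono ((hT₀ ⟨i, rfl⟩).trans hT)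
  obtain ⟨D, hD₀, hD⟩ := exists_pos_forall_image_subset hrec hJo hJne
  have hzero : ∀ i, f^[T] '' J i ⊆ orbitHull f T D (J i) := fun i => by
    simpa using subset_orbitHull f T D 0 (J i)
  have hS : ∀ i, (orbitHull f T D (J i)).OrdConnected := fun i =>
    ordConnected_orbitHull hf (hJc i) (hD i)
  have hnear : ∀ i j, ∀ η > 0, ∃ x ∈ orbitHull f T D (J i), ∃ y ∈ orbitHull f T D (J j),
      dist x y < η := by
    intro i j η hη
    obtain ⟨x, hx, y, hy, hp, -⟩ := hLY _ _ (hJo i) (hJne i) (hJo j) (hJne j)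
    obtain ⟨k, hk⟩ := exists_dist_lt_arith hf hp hη T hD₀
    exact ⟨_, subset_orbitHull f T D k _ ⟨x, hx, rfl⟩, _,
      subset_orbitHull f T D k _ ⟨y, hy, rfl⟩, hk⟩
  have hnt : ∀ i, (orbitHull f T D (J i)).Nontrivial := by
    intro i
    obtain ⟨x, hx, y, hy, -, hp⟩ := hLY _ _ (hJo i) (hJne i) (hJo i) (hJne i)
    refine ⟨_, hzero i ⟨x, hx, rfl⟩, _, hzero i ⟨y, hy, rfl⟩, fun heq => ?_⟩
    obtain ⟨n, hn, hlt⟩ := hp T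
    rw [← Nat.sub_add_cancel hn, Function.iterate_add_apply, Function.iterate_add_apply, heq,
      dist_self] at hlt
    exact hlt.not_gt hε
  refine ⟨J, hJV, hJo, hJne, {P | ∀ i, P i ∈ orbitHull f T D (J i)}, fun P hP W hW ho hne N =>
    exists_iterate_eq hrec hD hP hW ho hne N, fun η hη => ?_, ?_⟩
  · exact exists_pairwise_dist_lt hS hη fun i j => hnear i j _ (half_pos hη)
  · exact exists_forall_lt_dist hS hnt hε hnear
      (fun i j a b hab h₁ h₂ h₃ h₄ => orbitHull_subset_of_overlap hf (hJc i) (hJo i) (hJc j) hD₀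
        (hrec i) (hD i) (hD j) hab h₁ h₂ h₃ h₄)
      (hzero i₀ ⟨u, hu, rfl⟩) (hzero i₀ ⟨v, hv, rfl⟩) huv

end Interval

-- Baire category and Li-Yorke tuples

/-- Adjoining the complement of the closure of U makes each G k dense in all of X, so Baire's
theorem applies without passing to a subspace. -/
theorem exists_mem_forall_mem_of_baire {X κ : Type*} [TopologicalSpace X] [BaireSpace X]
    [Countable κ] {U : Set X} (hU : IsOpen U) (hne : U.Nonempty) {G : κ → Set X}
    (hG : ∀ k, IsOpen (G k))
    (h : ∀ k, ∀ V ⊆ U, IsOpen V → V.Nonempty → (V ∩ G k).Nonempty) :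
    ∃ x ∈ U, ∀ k, x ∈ G k := by
  have hd : Dense (⋂ k, G k ∪ (closure U)ᶜ) := by
    refine dense_iInter_of_isOpen (fun k => (hG k).union isClosed_closure.isOpen_compl)
      fun k => dense_iff_inter_open.2 fun V hV hVne => ?_
    rcases (V ∩ U).eq_empty_or_nonempty with hVU | hVU
    · obtain ⟨x, hx⟩ := hVne
      refine ⟨x, hx, Or.inr fun hxU => ?_⟩
      exact (mem_closure_iff.1 hxU V hV hx).ne_empty hVU
    · obtain ⟨x, hx, hxG⟩ := h k (V ∩ U) Set.inter_subset_right (hV.inter hU) hVU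
      exact ⟨x, hx.1, Or.inl hxG⟩
  obtain ⟨x, hxU, hx⟩ := hd.inter_open_nonempty U hU hne
  exact ⟨x, hxU, fun k => (Set.mem_iInter.1 hx k).resolve_right fun hc => hc (subset_closure hxU)⟩

/-- Near any finite tuple of points there is a proximal tuple one of whose members is infinitely
often `δ`-separated from all the others, for some `δ > ε`. -/
theorem exists_liYorke_tuple {f : unitInterval → unitInterval} {ε : ℝ} (hε : 0 < ε)
    (hf : Continuous f) (hLY : HasLiYorkePairs f ε) {ι : Type*} [Fintype ι] (i₀ : ι)
    {V : ι → Set unitInterval} (hV : ∀ i, IsOpen (V i)) (hVne : ∀ i, (V i).Nonempty) :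
    ∃ x : ι → unitInterval, (∀ i, x i ∈ V i) ∧
      (∀ η > 0, ∀ N : ℕ, ∃ n ≥ N, ∀ i j, dist (f^[n] (x i)) (f^[n] (x j)) < η) ∧
      ∃ δ > ε, ∀ N : ℕ, ∃ n ≥ N, ∀ j, j ≠ i₀ → δ < dist (f^[n] (x i₀)) (f^[n] (x j)) := by
  obtain ⟨J, hJV, hJo, hJne, R, hR, hnear, Q, hQR, hQ⟩ :=
    exists_simultaneous_iterates hε hf hLY i₀ hV hVne
  -- Finiteness leaves room for δ > ε; distances merely above ε infinitely often would only give
  -- limsup ≥ ε.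
  obtain ⟨δ, hδ, hδε⟩ : ∃ δ, (∀ j, j ≠ i₀ → δ < dist (Q i₀) (Q j)) ∧ ε < δ := by
    refine ((eventually_all.2 fun j => ?_).and
      (self_mem_nhdsWithin (a := ε) (s := Set.Ioi ε))).exists
    by_cases hj : j = i₀
    · exact Eventually.of_forall fun _ h => absurd hj h
    · exact (eventually_nhdsWithin_of_eventually_nhds (eventually_lt_nhds (hQ j hj))).mono
        fun _ h _ => h
  have hcont : ∀ n i, Continuous fun x : ι → unitInterval => f^[n] (x i) := fun n i =>
    (hf.iterate n).comp (continuous_apply i)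
  have hreach : ∀ P ∈ R, ∀ V' ⊆ Set.univ.pi J, IsOpen V' → V'.Nonempty → ∀ N,
      ∃ n ≥ N, ∃ w ∈ V', ∀ i, f^[n] (w i) = P i := by
    rintro P hP V' hV' hVo ⟨a, ha⟩ N
    obtain ⟨u, hu, huV⟩ := isOpen_pi_iff'.1 hVo a ha
    obtain ⟨n, hn, hw⟩ := hR P hP (fun i => u i ∩ J i) (fun i => Set.inter_subset_right)
      (fun i => (hu i).1.inter (hJo i)) (fun i => ⟨a i, (hu i).2, hV' ha i trivial⟩) N
    choose w hw hwP using hw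
    exact ⟨n, hn, w, huV fun i _ => (hw i).1, hwP⟩
  let G : ℕ ⊕ ℕ → Set (ι → unitInterval) := Sum.elim
    (fun N => ⋃ n ≥ N, ⋂ i, ⋂ j, {x | dist (f^[n] (x i)) (f^[n] (x j)) < 1 / (N + 1 : ℝ)})
    (fun N => ⋃ n ≥ N, ⋂ j, ⋂ (_ : j ≠ i₀), {x | δ < dist (f^[n] (x i₀)) (f^[n] (x j))})
  have hGo : ∀ k, IsOpen (G k) := by
    rintro (N | N)
    · exact isOpen_biUnion fun n _ => isOpen_iInter_of_finite fun i =>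
        isOpen_iInter_of_finite fun j => isOpen_lt ((hcont n i).dist (hcont n j)) continuous_const
    · exact isOpen_biUnion fun n _ => isOpen_iInter_of_finite fun j =>
        isOpen_iInter_of_finite fun _ => isOpen_lt continuous_const ((hcont n i₀).dist (hcont n j))
  have hGd : ∀ k, ∀ V' ⊆ Set.univ.pi J, IsOpen V' → V'.Nonempty → (V' ∩ G k).Nonempty := by
    rintro (N | N) V' hV' hVo hVn
    · obtain ⟨P, hP, hPd⟩ := hnear (1 / (N + 1 : ℝ)) (by positivity)
      obtain ⟨n, hn, w, hw, hwP⟩ := hreach P hP V' hV' hVo hVn N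
      refine ⟨w, hw, ?_⟩
      simp only [G, Sum.elim_inl, Set.mem_iUnion, Set.mem_iInter, Set.mem_ofPred_eq]
      exact ⟨n, hn, fun i j => by rw [hwP, hwP]; exact hPd i j⟩
    · obtain ⟨n, hn, w, hw, hwP⟩ := hreach Q hQR V' hV' hVo hVn N
      refine ⟨w, hw, ?_⟩
      simp only [G, Sum.elim_inr, Set.mem_iUnion, Set.mem_iInter, Set.mem_ofPred_eq]
      exact ⟨n, hn, fun j hj => by rw [hwP, hwP]; exact hδ j hj⟩
  obtain ⟨x, hxJ, hx⟩ := exists_mem_forall_mem_of_baire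
    (isOpen_set_pi Set.finite_univ fun i _ => hJo i) (Set.univ_pi_nonempty_iff.2 hJne) hGo hGd
  refine ⟨x, fun i => hJV i (hxJ i trivial), fun η hη N => ?_, δ, hδε, fun N => ?_⟩
  · obtain ⟨M, hM⟩ := exists_nat_one_div_lt hη
    have := hx (Sum.inl (max M N))
    simp only [G, Sum.elim_inl, Set.mem_iUnion, Set.mem_iInter, Set.mem_ofPred_eq] at this
    obtain ⟨n, hn, h⟩ := this
    refine ⟨n, (le_max_right _ _).trans hn, fun i j => (h i j).trans_le (le_trans ?_ hM.le)⟩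
    exact one_div_le_one_div_of_le (by positivity) (by gcongr; exact le_max_left _ _)
  · have := hx (Sum.inr N)
    simpa only [G, Sum.elim_inr, Set.mem_iUnion, Set.mem_iInter, Set.mem_ofPred_eq,
      exists_prop] using this

-- Finite sets in the hyperspace

section Hyperspace

variable {X : Type*} [MetricSpace X]

/-- The finite set of the members of a tuple, as a non-empty compact set. -/
def rangeCompacts {α : Type*} [Finite α] [Nonempty α] (x : α → X) : NonemptyCompacts X :=
  ⟨⟨Set.range x, (Set.finite_range x).isCompact⟩, Set.range_nonempty x⟩

theorem induced_iterate_rangeCompacts [CompactSpace X] (f : C(X, X)) {α : Type*} [Finite α]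
    [Nonempty α] (x : α → X) (n : ℕ) :
    (induced f)^[n] (rangeCompacts x) = rangeCompacts fun a => f^[n] (x a) := by
  induction n with
  | zero => rfl
  | succ n ih =>
    rw [Function.iterate_succ_apply', ih]
    refine NonemptyCompacts.ext ?_
    show f '' Set.range (fun a => f^[n] (x a)) = Set.range fun a => f^[n + 1] (x a)
    rw [← Set.range_comp]
    exact congrArg Set.range (funext fun a => (Function.iterate_succ_apply' f n (x a)).symm)

theorem dist_rangeCompacts_le {α β : Type*} [Finite α] [Nonempty α] [Finite β] [Nonempty β]
    {x : α → X} {y : β → X} {η : ℝ} (h : ∀ a b, dist (x a) (y b) ≤ η) :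
    dist (rangeCompacts x) (rangeCompacts y) ≤ η := by
  obtain ⟨a₀⟩ := ‹Nonempty α›
  obtain ⟨b₀⟩ := ‹Nonempty β›
  refine Metric.hausdorffDist_le_of_mem_dist (dist_nonneg.trans (h a₀ b₀)) ?_ ?_
  · rintro _ ⟨a, rfl⟩
    exact ⟨y b₀, ⟨b₀, rfl⟩, h a b₀⟩
  · rintro _ ⟨b, rfl⟩
    exact ⟨x a₀, ⟨a₀, rfl⟩, by rw [dist_comm]; exact h a₀ b⟩

theorem le_dist_rangeCompacts {α β : Type*} [Finite α] [Nonempty α] [Finite β] [Nonempty β]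
    {x : α → X} {y : β → X} {δ : ℝ} (a : α) (h : ∀ b, δ ≤ dist (x a) (y b)) :
    δ ≤ dist (rangeCompacts x) (rangeCompacts y) := by
  have h₁ : δ ≤ Metric.infDist (x a) (Set.range y) := by
    refine (Metric.le_infDist (Set.range_nonempty y)).2 ?_
    rintro _ ⟨b, rfl⟩
    exact h b
  refine h₁.trans (Metric.infDist_le_hausdorffDist_of_mem (Set.mem_range_self a) ?_)
  exact Metric.hausdorffEDist_ne_top_of_nonempty_of_bounded (Set.range_nonempty x)
    (Set.range_nonempty y) (Set.finite_range x).isBounded (Set.finite_range y).isBounded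

/-- A non-empty compact set has a finite subset all of whose perturbations are close to it. -/
theorem exists_finset_forall_dist_rangeCompacts_lt (K : NonemptyCompacts X) {r : ℝ}
    (hr : 0 < r) : ∃ (A : Finset X) (_ : Nonempty A), ∃ ρ > 0, ∀ x : A → X,
      (∀ a : A, x a ∈ Metric.ball (a : X) ρ) → dist (rangeCompacts x) K < r := by
  obtain ⟨A, hAK, hA, hcov⟩ := K.isCompact.finite_cover_balls (show 0 < r / 3 by linarith)
  lift A to Finset X using hA
  have hne : Nonempty A := by
    obtain ⟨k, hk⟩ := K.nonempty
    obtain ⟨a, ha, -⟩ := Set.mem_iUnion₂.1 (hcov hk)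
    exact ⟨⟨a, ha⟩⟩
  refine ⟨A, hne, r / 3, by linarith, fun x hx => ?_⟩
  refine lt_of_le_of_lt (Metric.hausdorffDist_le_of_mem_dist
    (r := r / 3 + r / 3) (by linarith) ?_ ?_) (by linarith)
  · rintro _ ⟨a, rfl⟩
    have := Metric.mem_ball.1 (hx a)
    exact ⟨a, hAK a.2, by linarith⟩
  · intro k hk
    obtain ⟨a, ha, hka⟩ := Set.mem_iUnion₂.1 (hcov hk)
    refine ⟨x ⟨a, ha⟩, ⟨_, rfl⟩, (dist_triangle_right _ _ a).trans ?_⟩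
    exact add_le_add (Metric.mem_ball.1 hka).le (Metric.mem_ball.1 (hx ⟨a, ha⟩)).le

end Hyperspace

end DenseChaos

theorem theorem4p4 (ε : ℝ) (hε : 0 < ε) (f : C(unitInterval, unitInterval))
    (hf : DenseChaos.DenselyChaotic f ε) :
    DenseChaos.DenselyChaotic (DenseChaos.induced f) ε := by
  open DenseChaos in
  refine dense_iff_inter_open.2 ?_
  rintro U hU ⟨⟨K, L⟩, hKL⟩
  obtain ⟨r, hr, hball⟩ := Metric.isOpen_iff.1 hU _ hKL
  obtain ⟨A, hA, ρ, hρ, hAK⟩ := exists_finset_forall_dist_rangeCompacts_lt K hr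
  obtain ⟨B, hB, σ, hσ, hBL⟩ := exists_finset_forall_dist_rangeCompacts_lt L hr
  have a₀ : A := Classical.arbitrary A
  obtain ⟨x, hx, hprox, δ, hδ, hfar⟩ := exists_liYorke_tuple hε f.continuous hf.hasLiYorkePairs
    (Sum.inl a₀ : A ⊕ B)
    (V := Sum.elim (fun a : A => Metric.ball (a : unitInterval) ρ)
      fun b : B => Metric.ball (b : unitInterval) σ)
    (Sum.rec (fun _ => Metric.isOpen_ball) fun _ => Metric.isOpen_ball)
    (Sum.rec (fun a => ⟨a, Metric.mem_ball_self hρ⟩) fun b => ⟨b, Metric.mem_ball_self hσ⟩)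
  refine ⟨(rangeCompacts fun a : A => x (Sum.inl a), rangeCompacts fun b : B => x (Sum.inr b)),
    hball ?_, mem_C₁_iff.2 fun η hη N => ?_, mem_C₂_of_frequently hδ fun N => ?_⟩
  · rw [Metric.mem_ball, Prod.dist_eq]
    exact max_lt (hAK _ fun a => hx (Sum.inl a)) (hBL _ fun b => hx (Sum.inr b))
  · obtain ⟨n, hn, h⟩ := hprox (η / 2) (half_pos hη) N
    refine ⟨n, hn, lt_of_le_of_lt ?_ (half_lt_self hη)⟩
    rw [induced_iterate_rangeCompacts, induced_iterate_rangeCompacts]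
    exact dist_rangeCompacts_le fun a b => (h _ _).le
  · obtain ⟨n, hn, h⟩ := hfar N
    refine ⟨n, hn, ?_⟩
    rw [induced_iterate_rangeCompacts, induced_iterate_rangeCompacts]
    exact le_dist_rangeCompacts a₀ fun b => (h (Sum.inr b) (by simp)).le
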